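/- **Conventions.** Let $T$ be a topological semigroup with a neutral element $e$ (jointly continuous multiplication) and let $X$ be a nonempty compact Hausdorff space. A *semiflow* $(T,X)$ is a jointly continuous action $T\times X\to X$, $(t,x)\mapsto tx$, with $ex=x$ and $(ts)x=t(sx)$. It is *minimal* if the orbit $Tx$ of every $x\in X$ is dense in $X$. It is *weakly almost periodic* if for every continuous $f\colon X\to\mathbb R$ the set $\{f_t : t\in T\}$ of translates $f_t(x)=f(tx)$ is relatively compact in $C(X,\mathbb R)$ for the topology of pointwise convergence. A Borel probability measure $\mu$ on $X$ is *invariant* if $\mu(t^{-1}B)=\mu(B)$ for every $t\in T$ and every Borel set $B\subseteq X$, where $t^{-1}B=\{x : tx\in B\}$. The semiflow is *uniquely ergodic* if there is exactly one invariant Borel probability measure on $X$. The topological semigroup $T$ is *amenable* if every semiflow $(T,Y)$ of $T$ on a nonempty compact Hausdorff space $Y$ admits an invariant Borel probability measure. **Theorem.** Let $(T,X)$ be a minimal weakly almost periodic semiflow with amenable phase semigroup $T$ such that for each $t\in T$ the map $x\mapsto tx$ is a bijection of $X$. Then $(T,X)$ is uniquely ergodic. -/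

import Mathlib

universe u v

/-- The topology of pointwise convergence on `C(X, ℝ)`. -/
@[reducible]
def pointwiseTopology (X : Type*) [TopologicalSpace X] : TopologicalSpace C(X, ℝ) :=
  TopologicalSpace.induced (fun (f : C(X, ℝ)) (x : X) => f x) inferInstance

/-- The translate `f_t : x ↦ f (t x)` of a continuous function along an action by continuous
maps. -/
def actionTranslate {T X : Type*} [TopologicalSpace X] [SMul T X] [ContinuousConstSMul T X]
    (f : C(X, ℝ)) (t : T) : C(X, ℝ) :=
  ⟨fun x => f (t • x), f.continuous.comp (continuous_const_smul t)⟩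

/-- The action of `T` on `X` is weakly almost periodic: for each `f ∈ C(X, ℝ)` the set
`T f = {f_t | t ∈ T}` is relatively compact in `C(X, ℝ)` for the topology of pointwise
convergence, i.e. its closure there is compact. -/
def IsWeaklyAlmostPeriodic (T X : Type*) [TopologicalSpace X] [SMul T X]
    [ContinuousConstSMul T X] : Prop :=
  ∀ f : C(X, ℝ),
    @IsCompact C(X, ℝ) (pointwiseTopology X)
      (@closure C(X, ℝ) (pointwiseTopology X) (Set.range fun t : T => actionTranslate f t))

/-- `μ` is an invariant Borel probability measure: `μ (t⁻¹ B) = μ B` for all `t` and all Borel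
sets `B`. -/
def IsInvariantProbability (T : Type*) {X : Type*} [SMul T X] [MeasurableSpace X]
    (μ : MeasureTheory.Measure X) : Prop :=
  MeasureTheory.IsProbabilityMeasure μ ∧ MeasureTheory.SMulInvariantMeasure T X μ

/-- A topological monoid `T` is amenable if every semiflow of `T` on a nonempty compact Hausdorff
space admits an invariant Borel probability measure. The phase spaces range over a universe at
least as large as that of `T`. -/
def IsAmenable (T : Type u) [TopologicalSpace T] [Monoid T] : Prop :=
  ∀ (Y : Type (max u v)) [TopologicalSpace Y] [CompactSpace Y] [T2Space Y] [Nonempty Y]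
    [MeasurableSpace Y] [BorelSpace Y] [MulAction T Y] [ContinuousSMul T Y],
    ∃ μ : MeasureTheory.Measure Y, IsInvariantProbability T μ

/-- The action of `T` on `X` is uniquely ergodic: there is exactly one invariant Borel probability
measure. -/
def IsUniquelyErgodic (T X : Type*) [SMul T X] [MeasurableSpace X] : Prop :=
  ∃! μ : MeasureTheory.Measure X, IsInvariantProbability T μ

/-! Weak almost periodicity makes every member of the enveloping semigroup `E` continuous.
Integration is continuous on each `translateClosure T f` (closures in it are sequential, so
dominated convergence applies), hence an invariant probability `μ` is preserved by all of `E`, not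
only by `T`. Minimality gives `μ` full support, so members of `E` are surjective. A surjective
idempotent is the identity, and by Ellis–Numakura `E` is a group. An L² and Baire argument yields an
open set on which all translates of `f` oscillate little. Its images under `T` are open by
bijectivity and cover `X`, so the system is equicontinuous. The closed convex hull of the translates
is then compact and contains a constant, so all invariant probabilities integrate `f` alike.

This does not finish the proof: without metrizability a Borel measure need not be regular, nor be
determined by its integrals of continuous functions. For a regular invariant `μ`, however, each
closed `F` contains a closed Gδ set of the same measure (`measure_le_of_isClosed`). A closed Gδ set
is a level set of a continuous function, so `μ F ≤ ν F` for every invariant `ν`, and this forces `ν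
= μ`. -/

open MeasureTheory Set Filter Topology

/-! ### Pointwise compact sets of continuous functions -/

/-- A pointwise compact set of continuous functions on a compact space is angelic: closures in it
are given by sequences. -/
theorem exists_seq_tendsto_of_mem_closure_of_isCompact {X : Type*} [TopologicalSpace X]
    [CompactSpace X] {K A : Set (X → ℝ)} (hK : IsCompact K) (hcont : ∀ k ∈ K, Continuous k)
    (hA : A ⊆ K) {k₀ : X → ℝ} (hk₀ : k₀ ∈ closure A) :
    ∃ k : ℕ → X → ℝ, (∀ n, k n ∈ A) ∧ ∀ x, Tendsto (fun n => k n x) atTop (𝓝 (k₀ x)) := by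
  have hk₀K : k₀ ∈ K := closure_minimal hA hK.isClosed hk₀
  have hc₀ := hcont k₀ hk₀K
  have hfin : ∀ n : ℕ, ∃ B : Set (X → ℝ), B ⊆ A ∧ B.Finite ∧
      ∀ x : Fin n → X, ∃ k ∈ B, ∀ i, |k (x i) - k₀ (x i)| < 1 / ((n : ℝ) + 1) := by
    intro n
    -- Compactness of `X ^ n` makes one finite subset of `A` serve all `n`-tuples of points.
    let U : A → Set (Fin n → X) := fun k =>
      ⋂ i, {x | |k.1 (x i) - k₀ (x i)| < 1 / ((n : ℝ) + 1)}
    have hU : ∀ k, IsOpen (U k) := by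
      intro k
      have := hcont k.1 (hA k.2)
      exact isOpen_iInter_of_finite fun i => isOpen_lt (by fun_prop) continuous_const
    have hcov : (univ : Set (Fin n → X)) ⊆ ⋃ k, U k := by
      intro x _
      have hopen : IsOpen {k : X → ℝ | ∀ i, |k (x i) - k₀ (x i)| < 1 / ((n : ℝ) + 1)} := by
        rw [ofPred_forall]
        exact isOpen_iInter_of_finite fun i => isOpen_lt (by fun_prop) continuous_const
      obtain ⟨k, hk, hkA⟩ := mem_closure_iff.1 hk₀ _ hopen (by
        intro i; simp only [sub_self, abs_zero]; positivity)
      exact mem_iUnion.2 ⟨⟨k, hkA⟩, mem_iInter.2 hk⟩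
    obtain ⟨t, ht⟩ := isCompact_univ.elim_finite_subcover U hU hcov
    refine ⟨Subtype.val '' (t : Set A), ?_, t.finite_toSet.image _, fun x => ?_⟩
    · rintro _ ⟨k, -, rfl⟩; exact k.2
    · obtain ⟨k, hk, hx⟩ := mem_iUnion₂.1 (ht (mem_univ x))
      exact ⟨k.1, ⟨k, hk, rfl⟩, by simpa [U] using hx⟩
  choose B hBA hBfin hB using hfin
  -- `C` is countable, so the image of `X` in `ℝ ^ C` is separable; `d` lifts a dense sequence of
  -- it.
  let C : Set (X → ℝ) := insert k₀ (⋃ n, B n)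
  have hCc : C.Countable := (countable_iUnion fun n => (hBfin n).countable).insert _
  have : Countable C := hCc.to_subtype
  let φ : X → C → ℝ := fun x k => k.1 x
  obtain h | h := isEmpty_or_nonempty X
  · obtain ⟨k, hk⟩ := closure_nonempty_iff.1 ⟨k₀, hk₀⟩
    exact ⟨fun _ => k, fun _ => hk, fun x => (h.false x).elim⟩
  have : Nonempty (range φ) := (range_nonempty φ).to_subtype
  obtain ⟨u, hu⟩ := TopologicalSpace.exists_dense_seq (range φ)
  choose d hd using fun n => (u n).2
  have hdense : ∀ x, φ x ∈ closure (range fun n => φ (d n)) := by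
    intro x
    have h1 : (⟨φ x, mem_range_self x⟩ : range φ) ∈ closure (range u) := hu _
    have h2 := image_closure_subset_closure_image (continuous_subtype_val (p := (· ∈ range φ)))
      (mem_image_of_mem _ h1)
    rw [← range_comp] at h2
    convert! h2 using 3
    funext n
    exact hd n
  choose k hkB hk using fun n => hB n (fun i => d i)
  have hkA : ∀ n, k n ∈ A := fun n => hBA n (hkB n)
  refine ⟨k, hkA, fun x => ?_⟩
  have hkd : ∀ i, Tendsto (fun n => k n (d i)) atTop (𝓝 (k₀ (d i))) := by
    intro i
    rw [tendsto_iff_dist_tendsto_zero]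
    refine squeeze_zero' (Eventually.of_forall fun _ => dist_nonneg) ?_
      tendsto_one_div_add_atTop_nhds_zero_nat
    filter_upwards [eventually_gt_atTop i] with n hn
    exact (hk n ⟨i, hn⟩).le
  rw [tendsto_iff_ultrafilter]
  intro g hg
  obtain ⟨k', hk'K, hk'⟩ := hK.ultrafilter_le_nhds (g.map k) 
    (le_principal_iff.2 (Filter.mem_map.2 (univ_mem' fun n => hA (hkA n))))
  have hk't : ∀ y, Tendsto (fun n => k n y) g (𝓝 (k' y)) := fun y =>
    ((continuous_apply y).tendsto k').comp hk'
  have hk'd : ∀ i, k' (d i) = k₀ (d i) := fun i =>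
    tendsto_nhds_unique (hk't (d i)) ((hkd i).mono_left hg)
  -- A limit `x'` of the points `d n` is sought that no function in `C` separates from `x`. There
  -- `k' = k₀` by continuity, and neither `k'` nor `k₀` distinguishes `x'` from `x`.
  have hne : (comap (fun n => φ (d n)) (𝓝 (φ x))).NeBot := by
    rw [comap_neBot_iff]
    intro s hs
    obtain ⟨_, h1, ⟨n, rfl⟩⟩ := mem_closure_iff_nhds.1 (hdense x) s hs
    exact ⟨n, h1⟩
  let q : Ultrafilter ℕ := Ultrafilter.of (comap (fun n => φ (d n)) (𝓝 (φ x)))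
  have hq : Tendsto (fun n => φ (d n)) q (𝓝 (φ x)) :=
    tendsto_comap.mono_left (Ultrafilter.of_le _)
  obtain ⟨x', -, hx'⟩ := isCompact_univ.ultrafilter_le_nhds (q.map d) (by simp)
  have hdx' : Tendsto d q (𝓝 x') := hx'
  have hC : ∀ c ∈ C, c x' = c x := by
    intro c hc
    have hcc : Continuous c := by
      rcases hc with rfl | hc
      · exact hc₀
      · obtain ⟨n, hn⟩ := mem_iUnion.1 hc
        exact hcont c (hA (hBA n hn))
    exact tendsto_nhds_unique ((hcc.tendsto x').comp hdx')
      (((continuous_apply (⟨c, hc⟩ : C)).tendsto (φ x)).comp hq)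
  have h1 : k' x' = k' x := by
    refine tendsto_nhds_unique (hk't x') ?_
    have : (fun n => k n x') = fun n => k n x := by
      funext n
      exact hC _ (Or.inr (mem_iUnion.2 ⟨n, hkB n⟩))
    rw [this]
    exact hk't x
  have h2 : k' x' = k₀ x' := by
    refine tendsto_nhds_unique (((hcont k' hk'K).tendsto x').comp hdx') ?_
    have : (k' ∘ d) = k₀ ∘ d := funext hk'd
    rw [this]
    exact (hc₀.tendsto x').comp hdx'
  rw [← hC k₀ (Or.inl rfl), ← h2, h1]
  exact hk't x

/-- On a bounded pointwise compact set of continuous functions, integration against a finite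
measure is continuous for pointwise convergence. -/
theorem continuousOn_integral_of_isCompact {X : Type*} [TopologicalSpace X] [CompactSpace X]
    [MeasurableSpace X] [BorelSpace X] (μ : Measure X) [IsFiniteMeasure μ]
    {K : Set (X → ℝ)} (hK : IsCompact K) (hcont : ∀ k ∈ K, Continuous k) {M : ℝ}
    (hM : ∀ k ∈ K, ∀ x, |k x| ≤ M) : ContinuousOn (fun k : X → ℝ => ∫ x, k x ∂μ) K := by
  intro k₀ hk₀
  by_contra hnot
  rw [ContinuousWithinAt, Metric.tendsto_nhds] at hnot
  push Not at hnot
  obtain ⟨ε, hε, hfr⟩ := hnot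
  have hcl : k₀ ∈ closure {k | k ∈ K ∧ ε ≤ dist (∫ x, k x ∂μ) (∫ x, k₀ x ∂μ)} := by
    rw [mem_closure_iff_frequently]
    exact (frequently_nhdsWithin_iff.1 hfr).mono fun k h => ⟨h.2, h.1⟩
  obtain ⟨k, hkA, hk⟩ := exists_seq_tendsto_of_mem_closure_of_isCompact hK hcont
    (fun k h => h.1) hcl
  have hlim : Tendsto (fun n => ∫ x, k n x ∂μ) atTop (𝓝 (∫ x, k₀ x ∂μ)) := by
    refine tendsto_integral_of_dominated_convergence (fun _ => M) (fun n => ?_)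
      (integrable_const M) (fun n => ?_) (Eventually.of_forall hk)
    · exact (hcont _ (hkA n).1).aestronglyMeasurable_of_compactSpace
    · exact Eventually.of_forall fun x => hM _ (hkA n).1 x
  obtain ⟨n, hn⟩ := (Metric.tendsto_nhds.1 hlim ε hε).exists
  exact absurd hn (not_lt.2 (hkA n).2)

/-- A bounded pointwise compact set of continuous functions on a compact Hausdorff space which
carries a finite measure of full support has small oscillation on some nonempty open set. -/
theorem exists_isOpen_forall_abs_sub_le_of_isCompact {X : Type*} [TopologicalSpace X]
    [CompactSpace X] [T2Space X] [Nonempty X] [MeasurableSpace X] [BorelSpace X] (μ : Measure X)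
    [IsFiniteMeasure μ] [μ.IsOpenPosMeasure] {K : Set (X → ℝ)} (hK : IsCompact K)
    (hcont : ∀ k ∈ K, Continuous k) {M : ℝ} (hM : ∀ k ∈ K, ∀ x, |k x| ≤ M) {ε : ℝ} (hε : 0 < ε) :
    ∃ V : Set X, IsOpen V ∧ V.Nonempty ∧ ∀ k ∈ K, ∀ x ∈ V, ∀ y ∈ V, |k x - k y| ≤ 4 * ε := by
  -- `Q` is the squared L² distance. Full support makes it separate the points of `K`.
  let s : (X → ℝ) × (X → ℝ) → X → ℝ := fun p x => (p.1 x - p.2 x) ^ 2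
  have hs : Continuous s := by fun_prop
  let Q : (X → ℝ) × (X → ℝ) → ℝ := fun p => ∫ x, s p x ∂μ
  have hsc : ∀ p ∈ K ×ˢ K, Continuous (s p) := by
    intro p hp
    have h1 := hcont _ hp.1
    have h2 := hcont _ hp.2
    fun_prop
  have hQ : ContinuousOn Q (K ×ˢ K) := by
    refine (continuousOn_integral_of_isCompact μ ((hK.prod hK).image hs) (M := (2 * M) ^ 2)
      ?_ ?_).comp hs.continuousOn (mapsTo_image _ _)
    · rintro _ ⟨p, hp, rfl⟩; exact hsc p hp
    · rintro _ ⟨p, hp, rfl⟩ x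
      have h1 := abs_le.1 (hM _ hp.1 x)
      have h2 := abs_le.1 (hM _ hp.2 x)
      rw [abs_of_nonneg (sq_nonneg _)]
      exact sq_le_sq' (by linarith) (by linarith)
  have hQ0 : ∀ p ∈ K ×ˢ K, Q p ≤ 0 → p.1 = p.2 := by
    intro p hp h
    have hnn : 0 ≤ s p := fun x => sq_nonneg _
    have h0 : Q p = 0 := le_antisymm h (integral_nonneg hnn)
    have hint : Integrable (s p) μ := (hsc p hp).integrable_of_hasCompactSupport
      (HasCompactSupport.of_compactSpace _)
    have h1 := ((hsc p hp).ae_eq_iff_eq μ continuous_zero).1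
      ((integral_eq_zero_iff_of_nonneg hnn hint).1 h0)
    funext x
    have := congrFun h1 x
    simpa [s, sub_eq_zero] using this
  -- `A n` collects the points where L²-closeness at scale `n` forces `ε`-closeness of values.
  -- Compactness of `K ×ˢ K` puts each point in some `A n`, and Baire gives one of them an interior.
  let A : ℕ → Set X := fun n =>
    {x | ∀ p ∈ K ×ˢ K, Q p ≤ 1 / ((n : ℝ) + 1) → |p.1 x - p.2 x| ≤ ε}
  have hAclosed : ∀ n, IsClosed (A n) := by
    intro n
    simp only [A, ofPred_forall]
    refine isClosed_iInter fun p => isClosed_iInter fun hp => isClosed_iInter fun _ => ?_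
    have h1 := hcont _ hp.1
    have h2 := hcont _ hp.2
    exact isClosed_le (by fun_prop) continuous_const
  have hAU : ⋃ n, A n = univ := by
    refine eq_univ_of_forall fun x => mem_iUnion.2 ?_
    let R : Set ((X → ℝ) × (X → ℝ)) := (K ×ˢ K) ∩ {p | ε ≤ |p.1 x - p.2 x|}
    have hR : IsCompact R :=
      (hK.prod hK).inter_right (isClosed_le continuous_const (by fun_prop))
    obtain hR0 | hR0 := R.eq_empty_or_nonempty
    · refine ⟨0, fun p hp _ => ?_⟩
      by_contra hlt
      exact (hR0 ▸ (⟨hp, (not_le.1 hlt).le⟩ : p ∈ R) : p ∈ (∅ : Set _))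
    · obtain ⟨p₀, hp₀, hmin⟩ := hR.exists_isMinOn hR0 (hQ.mono inter_subset_left)
      have hpos : 0 < Q p₀ := by
        by_contra hle
        have h1 := hQ0 p₀ hp₀.1 (not_lt.1 hle)
        have h2 : ε ≤ |p₀.1 x - p₀.2 x| := hp₀.2
        rw [h1, sub_self, abs_zero] at h2
        linarith
      obtain ⟨n, hn⟩ := exists_nat_one_div_lt hpos
      refine ⟨n, fun p hp hle => ?_⟩
      by_contra hlt
      have : Q p₀ ≤ Q p := hmin (⟨hp, (not_le.1 hlt).le⟩ : p ∈ R)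
      linarith
  obtain ⟨n, x₀, hx₀⟩ := nonempty_interior_of_iUnion_of_closed hAclosed hAU
  have hδ : (0 : ℝ) < 1 / ((n : ℝ) + 1) := by positivity
  -- A finite L²-net `t` of `K`. The bound `4 * ε` comes from the chain `k x`, `j x`, `j x₀`, `j y`,
  -- `k y` with `j` in the net.
  obtain ⟨t, htK, ht⟩ := hK.elim_nhdsWithin_subcover
    (fun k => {k' | Q (k, k') < 1 / ((n : ℝ) + 1)}) (by
      intro k hk
      have h1 : ContinuousWithinAt (fun k' => Q (k, k')) K k :=
        (hQ (k, k) ⟨hk, hk⟩).comp (f := fun k' => (k, k')) (by fun_prop)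
          (fun k' hk' => ⟨hk, hk'⟩)
      have h2 : Q (k, k) = 0 := by simp [Q, s]
      exact h1.eventually_lt continuousWithinAt_const (by simpa [h2] using hδ))
  refine ⟨interior (A n) ∩ ⋂ k ∈ t, {x | |k x - k x₀| < ε}, isOpen_interior.inter ?_,
    ⟨x₀, hx₀, ?_⟩, ?_⟩
  · refine isOpen_biInter_finset fun k hk => ?_
    have := hcont k (htK k hk)
    exact isOpen_lt (by fun_prop) continuous_const
  · simp [hε]
  · rintro k hk x ⟨hxA, hx⟩ y ⟨hyA, hy⟩
    obtain ⟨j, hj, hjk⟩ := mem_iUnion₂.1 (ht hk)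
    have hjK := htK j hj
    have h1 := interior_subset hxA (j, k) ⟨hjK, hk⟩ (le_of_lt hjk)
    have h2 := interior_subset hyA (j, k) ⟨hjK, hk⟩ (le_of_lt hjk)
    have h3 : |j x - j x₀| < ε := mem_iInter₂.1 hx j hj
    have h4 : |j y - j x₀| < ε := mem_iInter₂.1 hy j hj
    simp only at h1 h2
    rw [abs_le] at *
    rw [abs_lt] at h3 h4
    constructor <;> linarith [h1.1, h1.2, h2.1, h2.2]

/-! ### The enveloping semigroup -/

section Enveloping

variable {T X : Type*} [TopologicalSpace X] [Monoid T] [MulAction T X]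

/-- The closure of the set of translates of `f`, for the topology of pointwise convergence. -/
def translateClosure (T : Type*) {X : Type*} [TopologicalSpace X] [SMul T X] (f : C(X, ℝ)) :
    Set (X → ℝ) :=
  closure (range fun (t : T) (x : X) => f (t • x))

/-- The enveloping (Ellis) semigroup of an action. -/
def envelopingSemigroup (T X : Type*) [TopologicalSpace X] [SMul T X] : Set (X → X) :=
  closure (range fun (t : T) (x : X) => t • x)

theorem translate_mem_translateClosure (f : C(X, ℝ)) (t : T) :
    (fun x => f (t • x)) ∈ translateClosure T f :=
  subset_closure ⟨t, rfl⟩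

theorem comp_mem_translateClosure (f : C(X, ℝ)) {p : X → X} (hp : p ∈ envelopingSemigroup T X) :
    (fun x => f (p x)) ∈ translateClosure T f := by
  have hc : Continuous fun (p : X → X) (x : X) => f (p x) := by fun_prop
  have h := image_closure_subset_closure_image hc (mem_image_of_mem _ hp)
  rw [← range_comp] at h
  exact h

theorem abs_le_norm_of_mem_translateClosure [CompactSpace X] (f : C(X, ℝ)) {k : X → ℝ}
    (hk : k ∈ translateClosure T f) (x : X) : |k x| ≤ ‖f‖ := by
  have hcl : IsClosed {k : X → ℝ | |k x| ≤ ‖f‖} := isClosed_le (by fun_prop) continuous_const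
  refine closure_minimal ?_ hcl hk
  rintro _ ⟨t, rfl⟩
  exact f.norm_coe_le_norm (t • x)

theorem isCompact_translateClosure [CompactSpace X] (f : C(X, ℝ)) :
    IsCompact (translateClosure T f) := by
  refine (isCompact_univ_pi fun _ : X => isCompact_Icc (a := -‖f‖) (b := ‖f‖)).of_isClosed_subset
    isClosed_closure fun k hk x _ => ?_
  exact abs_le.1 (abs_le_norm_of_mem_translateClosure f hk x)

/-- The compact closure in `C(X, ℝ)` has compact, hence closed, image in `X → ℝ`, so closing up
among all functions adds nothing discontinuous. -/
theorem IsWeaklyAlmostPeriodic.continuous_of_mem_translateClosure [ContinuousConstSMul T X]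
    (hwap : IsWeaklyAlmostPeriodic T X) (f : C(X, ℝ)) {k : X → ℝ}
    (hk : k ∈ translateClosure T f) : Continuous k := by
  let C := @closure C(X, ℝ) (pointwiseTopology X) (range fun t : T => actionTranslate f t)
  have hC : IsCompact ((fun (g : C(X, ℝ)) (x : X) => g x) '' C) := by
    let := pointwiseTopology X
    exact (hwap f).image continuous_induced_dom
  have hsub : translateClosure T f ⊆ (fun (g : C(X, ℝ)) (x : X) => g x) '' C := by
    refine closure_minimal ?_ hC.isClosed
    rintro _ ⟨t, rfl⟩
    exact ⟨actionTranslate f t, @subset_closure _ (pointwiseTopology X) _ _ ⟨t, rfl⟩, rfl⟩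
  obtain ⟨g, -, rfl⟩ := hsub hk
  exact g.continuous

theorem one_mem_envelopingSemigroup : (fun x : X => x) ∈ envelopingSemigroup T X :=
  subset_closure ⟨1, by simp⟩

theorem comp_mem_envelopingSemigroup [ContinuousConstSMul T X] {p q : X → X}
    (hp : p ∈ envelopingSemigroup T X) (hq : q ∈ envelopingSemigroup T X) :
    p ∘ q ∈ envelopingSemigroup T X := by
  have h1 : ∀ t : T, (fun x => t • q x) ∈ envelopingSemigroup T X := by
    intro t
    have hc : Continuous fun (q : X → X) (x : X) => t • q x := by fun_prop
    refine map_mem_closure hc hq ?_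
    rintro _ ⟨s, rfl⟩
    exact ⟨t * s, funext fun x => mul_smul t s x⟩
  have hc : Continuous fun (p : X → X) => p ∘ q :=
    continuous_pi fun x => continuous_apply (q x)
  have hcl : IsClosed {p : X → X | p ∘ q ∈ envelopingSemigroup T X} :=
    isClosed_closure.preimage hc
  refine closure_minimal ?_ hcl hp
  rintro _ ⟨t, rfl⟩
  exact h1 t

theorem isCompact_envelopingSemigroup [CompactSpace X] :
    IsCompact (envelopingSemigroup T X) :=
  isClosed_closure.isCompact

theorem IsWeaklyAlmostPeriodic.continuous_of_mem_envelopingSemigroup [CompactSpace X] [T2Space X]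
    [ContinuousConstSMul T X] (hwap : IsWeaklyAlmostPeriodic T X) {p : X → X}
    (hp : p ∈ envelopingSemigroup T X) : Continuous p := by
  rw [continuous_iff_continuousAt]
  intro x U hU
  obtain ⟨V, hVU, hV, hxV⟩ := mem_nhds_iff.1 hU
  obtain ⟨f, hf0, hf1, -⟩ := exists_continuous_zero_one_of_isClosed
    (isClosed_singleton (x := p x)) hV.isClosed_compl (by simpa using hxV)
  have hc := hwap.continuous_of_mem_translateClosure f (comp_mem_translateClosure f hp)
  have hx : f (p x) = 0 := hf0 rfl
  have : ∀ᶠ y in 𝓝 x, f (p y) < 1 := by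
    refine (hc.tendsto x).eventually_lt_const ?_
    simp [hx]
  refine mem_map.2 (this.mono fun y hy => ?_)
  by_contra hyU
  have h1 : f (p y) = 1 := hf1 fun h => hyU (hVU h)
  linarith

end Enveloping

/-! ### Group structure and equicontinuity from an invariant measure -/

section InvariantMeasure

variable {T X : Type*} [TopologicalSpace X] [CompactSpace X]
  [MeasurableSpace X] [BorelSpace X] [Monoid T] [MulAction T X] [ContinuousConstSMul T X]
  {μ : Measure X}

theorem integral_translate_eq [SMulInvariantMeasure T X μ]
    (f : C(X, ℝ)) (t : T) : ∫ x, f (t • x) ∂μ = ∫ x, f x ∂μ := by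
  have hmap : μ.map (fun x => t • x) = μ := by
    ext B hB
    rw [Measure.map_apply (continuous_const_smul t).measurable hB]
    exact SMulInvariantMeasure.measure_preimage_smul t hB
  conv_rhs => rw [← hmap]
  rw [integral_map (continuous_const_smul t).measurable.aemeasurable
    f.continuous.aestronglyMeasurable_of_compactSpace]

/-- By minimality and compactness, finitely many preimages of a nonempty open set cover `X`, and all
have its measure. -/
theorem isOpenPosMeasure_of_isMinimal [MulAction.IsMinimal T X] [NeZero μ]
    [SMulInvariantMeasure T X μ] : μ.IsOpenPosMeasure := by
  refine ⟨fun U hU hne h0 => NeZero.ne (μ univ) ?_⟩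
  obtain ⟨t, ht⟩ := isCompact_univ.elim_finite_subcover (fun c : T => (c • ·) ⁻¹' U)
    (fun c => hU.preimage (continuous_const_smul c)) (hU.iUnion_preimage_smul T hne).ge
  refine measure_mono_null ht ((measure_biUnion_null_iff t.countable_toSet).2 fun c _ => ?_)
  rw [SMulInvariantMeasure.measure_preimage_smul c hU.measurableSet, h0]

theorem IsWeaklyAlmostPeriodic.integral_comp_eq [IsFiniteMeasure μ] [SMulInvariantMeasure T X μ]
    (hwap : IsWeaklyAlmostPeriodic T X) (f : C(X, ℝ)) {p : X → X}
    (hp : p ∈ envelopingSemigroup T X) : ∫ x, f (p x) ∂μ = ∫ x, f x ∂μ := by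
  have hcont := continuousOn_integral_of_isCompact μ (isCompact_translateClosure (T := T) f)
    (fun k hk => hwap.continuous_of_mem_translateClosure f hk)
    (fun k hk => abs_le_norm_of_mem_translateClosure f hk)
  have heq : EqOn (fun k : X → ℝ => ∫ x, k x ∂μ) (fun _ => ∫ x, f x ∂μ)
      (range fun (t : T) (x : X) => f (t • x)) := by
    rintro _ ⟨t, rfl⟩
    exact integral_translate_eq f t
  exact heq.of_subset_closure hcont continuousOn_const subset_closure subset_rfl
    (comp_mem_translateClosure f hp)

variable [T2Space X]

/-- A bump function vanishing on the closed range of `p` but not at a missed point would have both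
zero and positive integral. -/
theorem IsWeaklyAlmostPeriodic.surjective_of_mem_envelopingSemigroup [IsFiniteMeasure μ]
    [μ.IsOpenPosMeasure] [SMulInvariantMeasure T X μ]
    (hwap : IsWeaklyAlmostPeriodic T X) {p : X → X}
    (hp : p ∈ envelopingSemigroup T X) : Function.Surjective p := by
  intro y
  by_contra hy
  obtain ⟨f, hf0, hf1, hf⟩ := exists_continuous_zero_one_of_isClosed
    (isCompact_range (hwap.continuous_of_mem_envelopingSemigroup hp)).isClosed
    (isClosed_singleton (x := y)) (by simpa using hy)
  have h1 : ∫ x, f (p x) ∂μ = 0 := by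
    have : ∀ x, f (p x) = 0 := fun x => hf0 (mem_range_self x)
    simp [this]
  have h2 : 0 < ∫ x, f x ∂μ := by
    refine f.continuous.integral_pos_of_hasCompactSupport_nonneg_nonzero
      (HasCompactSupport.of_compactSpace _) (fun x => (hf x).1) (x := y) ?_
    rw [hf1 rfl]
    simp
  rw [hwap.integral_comp_eq f hp] at h1
  exact h2.ne' h1

/-- Every nonempty closed subsemigroup of the enveloping semigroup contains the identity. -/
theorem IsWeaklyAlmostPeriodic.one_mem_of_isClosed [IsFiniteMeasure μ]
    [μ.IsOpenPosMeasure] [SMulInvariantMeasure T X μ]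
    (hwap : IsWeaklyAlmostPeriodic T X) {S : Set (X → X)} (hS : S ⊆ envelopingSemigroup T X)
    (hcl : IsClosed S) (hne : S.Nonempty) (hmul : ∀ p ∈ S, ∀ q ∈ S, p ∘ q ∈ S) :
    (fun x : X => x) ∈ S := by
  let : Semigroup (X → X) :=
    { mul := fun p q => p ∘ q
      mul_assoc := fun _ _ _ => rfl }
  obtain ⟨u, huS, hu⟩ := exists_idempotent_in_compact_subsemigroup
    (fun r : X → X => continuous_pi fun x => continuous_apply (r x)) S hne hcl.isCompact hmul
  have hsurj := hwap.surjective_of_mem_envelopingSemigroup (μ := μ) (hS huS)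
  have : u = fun x => x := by
    funext x
    obtain ⟨y, rfl⟩ := hsurj x
    exact congrFun hu y
  exact this ▸ huS

theorem continuous_comp_right {X : Type*} [TopologicalSpace X] (q : X → X) :
    Continuous fun p : X → X => p ∘ q :=
  continuous_pi fun x => continuous_apply (q x)

/-- Elements of a closed subsemigroup of the enveloping semigroup have inverses in it. -/
theorem IsWeaklyAlmostPeriodic.exists_inverse_mem [IsFiniteMeasure μ]
    [μ.IsOpenPosMeasure] [SMulInvariantMeasure T X μ]
    (hwap : IsWeaklyAlmostPeriodic T X) {S : Set (X → X)} (hS : S ⊆ envelopingSemigroup T X)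
    (hcl : IsClosed S) (hmul : ∀ p ∈ S, ∀ q ∈ S, p ∘ q ∈ S) {p : X → X} (hp : p ∈ S) :
    ∃ q ∈ S, (∀ x, q (p x) = x) ∧ ∀ x, p (q x) = x := by
  -- `S ∘ p` is itself a closed subsemigroup, so it contains the identity, which gives a left
  -- inverse of `p` in `S`.
  have h := hwap.one_mem_of_isClosed (μ := μ) (S := (fun q : X → X => q ∘ p) '' S)
    (by rintro _ ⟨q, hq, rfl⟩; exact hS (hmul q hq p hp))
    (hcl.isCompact.image (continuous_comp_right p)).isClosed (Set.Nonempty.image _ ⟨p, hp⟩)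
    (by
      rintro _ ⟨q, hq, rfl⟩ _ ⟨r, hr, rfl⟩
      exact ⟨(q ∘ p) ∘ r, hmul _ (hmul q hq p hp) r hr, rfl⟩)
  obtain ⟨q, hq, hqp⟩ := h
  refine ⟨q, hq, congrFun hqp, fun x => ?_⟩
  obtain ⟨y, rfl⟩ := hwap.surjective_of_mem_envelopingSemigroup (μ := μ) (hS hp) x
  exact congrArg p (congrFun hqp y)

/-- A closed set which is invariant under preimages is empty or the whole space. -/
theorem IsWeaklyAlmostPeriodic.eq_empty_or_univ_of_preimage_subset [IsFiniteMeasure μ]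
    [μ.IsOpenPosMeasure] [SMulInvariantMeasure T X μ] [MulAction.IsMinimal T X]
    (hwap : IsWeaklyAlmostPeriodic T X) {F : Set X} (hF : IsClosed F)
    (hpre : ∀ t : T, (fun x => t • x) ⁻¹' F ⊆ F) : F = ∅ ∨ F = univ := by
  refine eq_empty_or_univ_of_smul_invariant_closed T hF fun t => ?_
  -- The inverse `p` of `t` maps `F` into itself. Members of `E` doing so form a closed
  -- subsemigroup, which therefore contains the inverse `q` of `p`; and `q` is the action of `t`.
  obtain ⟨p, hp, -, htp⟩ := hwap.exists_inverse_mem (μ := μ) subset_rfl isClosed_closure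
    (fun p hp q hq => comp_mem_envelopingSemigroup hp hq)
    (subset_closure ⟨t, rfl⟩ : (fun x : X => t • x) ∈ envelopingSemigroup T X)
  have hcl : IsClosed {q : X → X | ∀ x ∈ F, q x ∈ F} := by
    simp only [ofPred_forall]
    exact isClosed_iInter fun x => isClosed_iInter fun _ => hF.preimage (continuous_apply x)
  obtain ⟨q, hq, hqp, -⟩ := hwap.exists_inverse_mem (μ := μ)
    (S := envelopingSemigroup T X ∩ {q : X → X | ∀ x ∈ F, q x ∈ F}) inter_subset_left
    (isClosed_closure.inter hcl)
    (fun p hp q hq => ⟨comp_mem_envelopingSemigroup hp.1 hq.1,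
      fun x hx => hp.2 _ (hq.2 x hx)⟩)
    (p := p) ⟨hp, fun x hx => hpre t (by simpa only [mem_preimage, htp] using hx)⟩
  rintro _ ⟨x, hx, rfl⟩
  obtain ⟨y, rfl⟩ := hwap.surjective_of_mem_envelopingSemigroup (μ := μ) hp x
  have h1 : t • p y = q (p y) := (htp y).trans (hqp y).symm
  simp only [h1]
  exact hq.2 _ hx

/-- A minimal weakly almost periodic action by bijections with an invariant measure of full
support is equicontinuous. -/
theorem IsWeaklyAlmostPeriodic.exists_isOpen_forall_abs_sub_le [IsFiniteMeasure μ]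
    [μ.IsOpenPosMeasure] [SMulInvariantMeasure T X μ] [MulAction.IsMinimal T X]
    (hwap : IsWeaklyAlmostPeriodic T X)
    (hbij : ∀ t : T, Function.Bijective (fun x : X => t • x)) (f : C(X, ℝ)) {ε : ℝ} (hε : 0 < ε)
    (x : X) :
    ∃ W, IsOpen W ∧ x ∈ W ∧
      ∀ k ∈ translateClosure T f, ∀ y ∈ W, ∀ z ∈ W, |k y - k z| ≤ ε := by
  have : Nonempty X := ⟨x⟩
  obtain ⟨V, hVo, ⟨v₀, hv₀⟩, hV⟩ := exists_isOpen_forall_abs_sub_le_of_isCompact μ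
    (isCompact_translateClosure (T := T) f)
    (fun k hk => hwap.continuous_of_mem_translateClosure f hk)
    (fun k hk => abs_le_norm_of_mem_translateClosure f hk) (ε := ε / 4) (by positivity)
  have hopen : ∀ t : T, IsOpen ((fun x => t • x) '' V) := by
    intro t
    -- Bijectivity turns the complement of the image into the image of a compact set.
    rw [← isClosed_compl_iff, ← image_compl_eq (hbij t)]
    exact (hVo.isClosed_compl.isCompact.image (continuous_const_smul t)).isClosed
  have hempty : (⋃ t : T, (fun x => t • x) '' V)ᶜ = ∅ := by
    refine (hwap.eq_empty_or_univ_of_preimage_subset (μ := μ)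
      (isOpen_iUnion hopen).isClosed_compl fun t y hy hy' => ?_).resolve_right fun h => ?_
    · obtain ⟨s, v, hv, rfl⟩ := mem_iUnion.1 hy'
      exact hy (mem_iUnion.2 ⟨t * s, v, hv, mul_smul t s v⟩)
    · have h1 : v₀ ∈ (⋃ t : T, (fun x => t • x) '' V)ᶜ := h ▸ mem_univ v₀
      exact h1 (mem_iUnion.2 ⟨1, v₀, hv₀, one_smul T v₀⟩)
  rw [compl_empty_iff] at hempty
  obtain ⟨s, hs⟩ := mem_iUnion.1 (hempty ▸ mem_univ x)
  refine ⟨_, hopen s, hs, ?_⟩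
  rintro k hk _ ⟨y, hy, rfl⟩ _ ⟨z, hz, rfl⟩
  have hcl : IsClosed {k : X → ℝ | |k (s • y) - k (s • z)| ≤ ε} :=
    isClosed_le (by fun_prop) continuous_const
  refine closure_minimal ?_ hcl hk
  rintro _ ⟨t, rfl⟩
  have := hV _ (translate_mem_translateClosure f (t * s)) y hy z hz
  simp only [mul_smul] at this
  refine this.trans (by linarith)

end InvariantMeasure

/-! ### Uniqueness of the invariant functional -/

section UniqueFunctional

variable {T X : Type*} [TopologicalSpace X] [CompactSpace X]
  [Monoid T] [MulAction T X] [ContinuousConstSMul T X]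

theorem totallyBounded_range_actionTranslate (f : C(X, ℝ))
    (heq : ∀ ε : ℝ, 0 < ε → ∀ x, ∃ W, IsOpen W ∧ x ∈ W ∧
      ∀ k ∈ translateClosure T f, ∀ y ∈ W, ∀ z ∈ W, |k y - k z| ≤ ε) :
    TotallyBounded (range fun t : T => actionTranslate f t) := by
  have hcont : ∀ k ∈ translateClosure T f, Continuous k := by
    intro k hk
    rw [continuous_iff_continuousAt]
    intro x
    rw [ContinuousAt, Metric.tendsto_nhds]
    intro ε hε
    obtain ⟨W, hW, hx, h⟩ := heq (ε / 2) (by positivity) x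
    filter_upwards [hW.mem_nhds hx] with y hy
    rw [Real.dist_eq]
    linarith [h k hk y hy x hx]
  have hcomp : IsCompact {g : C(X, ℝ) | (g : X → ℝ) ∈ translateClosure T f} := by
    refine ArzelaAscoli.isCompact_of_equicontinuous _ ?_ ?_
    · convert! isCompact_translateClosure (T := T) f using 1
      refine Subset.antisymm (by rintro _ ⟨g, hg, rfl⟩; exact hg) fun k hk => ?_
      exact ⟨⟨k, hcont k hk⟩, hk, rfl⟩
    · intro x
      rw [Metric.equicontinuousAt_iff_right]
      intro ε hε
      obtain ⟨W, hW, hx, h⟩ := heq (ε / 2) (by positivity) x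
      filter_upwards [hW.mem_nhds hx] with y hy g
      rw [Real.dist_eq]
      linarith [h g.1 g.2 x hx y hy]
  refine hcomp.totallyBounded.subset ?_
  rintro _ ⟨t, rfl⟩
  exact translate_mem_translateClosure f t

/-- For an equicontinuous family of translates on a minimal system, some constant is a uniform
limit of averages of translates; hence invariant measures give `f` the same integral. -/
theorem exists_forall_integral_eq [Nonempty X] [MulAction.IsMinimal T X] [MeasurableSpace X]
    [BorelSpace X] (f : C(X, ℝ))
    (heq : ∀ ε : ℝ, 0 < ε → ∀ x, ∃ W, IsOpen W ∧ x ∈ W ∧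
      ∀ k ∈ translateClosure T f, ∀ y ∈ W, ∀ z ∈ W, |k y - k z| ≤ ε) :
    ∃ M : ℝ, ∀ ν : Measure X, IsInvariantProbability T ν → ∫ x, f x ∂ν = M := by
  let S : Set C(X, ℝ) := range fun t : T => actionTranslate f t
  let C : Set C(X, ℝ) := closure (convexHull ℝ S)
  have hCconv : Convex ℝ C := (convex_convexHull ℝ S).closure
  have hSC : S ⊆ C := (subset_convexHull ℝ S).trans subset_closure
  have hCmin : ∀ D : Set C(X, ℝ), Convex ℝ D → IsClosed D → S ⊆ D → C ⊆ D := fun D h1 h2 h3 =>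
    closure_minimal (convexHull_min h3 h1) h2
  have hCcomp : IsCompact C := TotallyBounded.isCompact_of_isClosed
    (totallyBounded_range_actionTranslate f heq).convexHull.closure isClosed_closure
  have hCne : C.Nonempty := ⟨_, hSC ⟨1, rfl⟩⟩
  have htrans : ∀ (t : T), ∀ g ∈ C, actionTranslate g t ∈ C := by
    intro t
    refine hCmin {g | actionTranslate g t ∈ C} ?_ ?_ ?_
    · intro g hg h hh a b ha hb hab
      exact hCconv hg hh ha hb hab
    · refine isClosed_closure.preimage ?_
      exact ContinuousMap.continuous_precomp (⟨fun x : X => t • x, continuous_const_smul t⟩ : C(X, X))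
    · rintro _ ⟨s, rfl⟩
      refine hSC ⟨s * t, ?_⟩
      ext x
      simp [actionTranslate, mul_smul]
  have hmaxcont : Continuous fun g : C(X, ℝ) => sSup ((fun x => g x) '' (univ : Set X)) :=
    isCompact_univ.continuous_sSup (f := fun (g : C(X, ℝ)) (x : X) => g x) (by fun_prop)
  -- `g` has the least maximum `M` in `C`; it turns out to be constant.
  obtain ⟨g, hgC, hg⟩ := hCcomp.exists_isMinOn hCne hmaxcont.continuousOn
  set M := sSup ((fun x => g x) '' (univ : Set X)) with hMdef
  have hbdd : ∀ h : C(X, ℝ), BddAbove ((fun x => h x) '' (univ : Set X)) := fun h =>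
    (isCompact_univ.image h.continuous).bddAbove
  have hle : ∀ x, g x ≤ M := fun x => le_csSup (hbdd g) ⟨x, mem_univ x, rfl⟩
  have hge : ∀ h ∈ C, ∃ x, M ≤ h x := by
    intro h hh
    obtain ⟨x, -, hx⟩ := (isCompact_univ.image h.continuous).sSup_mem (univ_nonempty.image _)
    exact ⟨x, by rw [hx]; exact hg hh⟩
  -- An average of finitely many translates of `g` stays in `C`, so it reaches `M` somewhere. Each
  -- term is at most `M`, so all of them equal `M` there; compactness passes to all `t`.
  have hne : (⋂ t : T, {x : X | g (t • x) = M}).Nonempty := by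
    have hcl : ∀ t : T, IsClosed {x : X | g (t • x) = M} := fun t =>
      isClosed_eq (by fun_prop) continuous_const
    rw [← univ_inter (⋂ t : T, {x : X | g (t • x) = M})]
    refine isCompact_univ.inter_iInter_nonempty _ hcl fun u => ?_
    rw [univ_inter]
    obtain rfl | hu := u.eq_empty_or_nonempty
    · simp
    have hcard : (0 : ℝ) < u.card := by exact_mod_cast hu.card_pos
    have hmem : ∑ t ∈ u, ((u.card : ℝ)⁻¹) • actionTranslate g t ∈ C :=
      hCconv.sum_mem (fun _ _ => by positivity) (by
        rw [Finset.sum_const, nsmul_eq_mul, mul_inv_cancel₀ hcard.ne'])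
        fun t _ => htrans t g hgC
    obtain ⟨x, hx⟩ := hge _ hmem
    have hx' : ∑ t ∈ u, M ≤ ∑ t ∈ u, g (t • x) := by
      have h1 : (∑ t ∈ u, ((u.card : ℝ)⁻¹) • actionTranslate g t) x =
          (u.card : ℝ)⁻¹ * ∑ t ∈ u, g (t • x) := by
        rw [ContinuousMap.sum_apply, Finset.mul_sum]
        rfl
      rw [h1] at hx
      rw [Finset.sum_const, nsmul_eq_mul]
      calc (u.card : ℝ) * M ≤ u.card * ((u.card : ℝ)⁻¹ * ∑ t ∈ u, g (t • x)) := by gcongr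
        _ = _ := by rw [← mul_assoc, mul_inv_cancel₀ hcard.ne', one_mul]
    have hsum := (Finset.sum_eq_sum_iff_of_le (s := u) (f := fun t => g (t • x))
      (g := fun _ => M) fun t _ => hle _).1
      (le_antisymm (Finset.sum_le_sum fun t _ => hle _) hx')
    exact ⟨x, mem_iInter₂.2 hsum⟩
  obtain ⟨x₀, hx₀⟩ := hne
  have hconst : ∀ x, g x = M := by
    have h1 : IsClosed {x : X | g x = M} := isClosed_eq g.continuous continuous_const
    intro x
    refine closure_minimal ?_ h1 (MulAction.dense_orbit T x₀ x)
    rintro _ ⟨t, rfl⟩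
    exact mem_iInter.1 hx₀ t
  refine ⟨M, fun ν hν => ?_⟩
  have := hν.1
  have := hν.2
  have hint : ∀ h : C(X, ℝ), Integrable h ν := fun h =>
    h.continuous.integrable_of_hasCompactSupport (HasCompactSupport.of_compactSpace _)
  have h1 : g ∈ {h : C(X, ℝ) | ∫ x, h x ∂ν = ∫ x, f x ∂ν} := by
    refine hCmin _ ?_ ?_ ?_ hgC
    · intro h hh k hk a b ha hb hab
      simp only [mem_ofPred_eq] at hh hk
      have : ∫ x, (a • h + b • k) x ∂ν = a * ∫ x, h x ∂ν + b * ∫ x, k x ∂ν := by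
        simp only [ContinuousMap.add_apply, ContinuousMap.smul_apply, smul_eq_mul]
        rw [integral_add ((hint h).const_mul a) ((hint k).const_mul b), integral_const_mul,
          integral_const_mul]
      rw [mem_ofPred_eq, this, hh, hk, ← add_mul, hab, one_mul]
    · refine isClosed_eq ?_ continuous_const
      refine (LipschitzWith.of_dist_le_mul (K := 1) fun h k => ?_).continuous
      rw [dist_eq_norm, dist_eq_norm, ← integral_sub (hint h) (hint k), NNReal.coe_one, one_mul]
      simpa using norm_integral_le_of_norm_le_const (μ := ν) (C := ‖h - k‖)
        (Eventually.of_forall fun x => (h - k).norm_coe_le_norm x)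
    · rintro _ ⟨t, rfl⟩
      exact integral_translate_eq f t
  have h2 : ∫ x, g x ∂ν = ∫ x, f x ∂ν := h1
  rw [← h2]
  simp [hconst]

end UniqueFunctional

/-! ### Closed sets and closed Gδ sets -/

section CompletionRegular

variable {T X : Type*} [TopologicalSpace X] [CompactSpace X]
  [Monoid T] [MulAction T X]

/-- Equicontinuity reduces the uniform estimate to finitely many points. -/
theorem eventually_forall_abs_sub_le (f : C(X, ℝ))
    (heq : ∀ ε : ℝ, 0 < ε → ∀ x, ∃ W, IsOpen W ∧ x ∈ W ∧
      ∀ k ∈ translateClosure T f, ∀ y ∈ W, ∀ z ∈ W, |k y - k z| ≤ ε)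
    {ι : Type*} {l : Filter ι} {p : ι → X → X} (hp : ∀ i, p i ∈ envelopingSemigroup T X)
    (hlim : ∀ x, Tendsto (fun i => p i x) l (𝓝 x)) {ε : ℝ} (hε : 0 < ε) :
    ∀ᶠ i in l, ∀ x, |f (p i x) - f x| ≤ ε := by
  choose W hWo hW h using heq (ε / 3) (by positivity)
  obtain ⟨t, ht⟩ := isCompact_univ.elim_finite_subcover W hWo
    fun x _ => mem_iUnion.2 ⟨x, hW x⟩
  have hf : (fun x => f x) ∈ translateClosure T f := by
    simpa using translate_mem_translateClosure f (1 : T)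
  have hev : ∀ᶠ i in l, ∀ x ∈ t, dist (f (p i x)) (f x) < ε / 3 :=
    t.eventually_all.2 fun x _ =>
      Metric.tendsto_nhds.1 ((f.continuous.tendsto x).comp (hlim x)) _ (by positivity)
  filter_upwards [hev] with i hi y
  obtain ⟨x, hx, hy⟩ := mem_iUnion₂.1 (ht (mem_univ y))
  have h1 := h x _ (comp_mem_translateClosure f (hp i)) y hy x (hW x)
  have h2 := h x _ hf x (hW x) y hy
  have h3 := (hi x hx).le
  rw [Real.dist_eq] at h3
  rw [abs_le] at *
  constructor <;> linarith [h1.1, h1.2, h2.1, h2.2]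

theorem exists_mem_envelopingSemigroup_apply_eq [T2Space X] [MulAction.IsMinimal T X] (x y : X) :
    ∃ p ∈ envelopingSemigroup T X, p x = y := by
  have h := isCompact_envelopingSemigroup (T := T) (X := X)
  refine closure_minimal ?_ (h.image (continuous_apply x)).isClosed
    (MulAction.dense_orbit T x y)
  rintro _ ⟨t, rfl⟩
  exact ⟨_, subset_closure ⟨t, rfl⟩, rfl⟩

variable [T2Space X] [ContinuousConstSMul T X] [MeasurableSpace X] [BorelSpace X]

theorem IsWeaklyAlmostPeriodic.exists_inverse {μ : Measure X}
  [IsFiniteMeasure μ] [μ.IsOpenPosMeasure] [SMulInvariantMeasure T X μ]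
    (hwap : IsWeaklyAlmostPeriodic T X)
    {p : X → X} (hp : p ∈ envelopingSemigroup T X) :
    ∃ q ∈ envelopingSemigroup T X, (∀ x, q (p x) = x) ∧ ∀ x, p (q x) = x :=
  hwap.exists_inverse_mem (μ := μ) subset_rfl isClosed_closure
    (fun _ hp _ hq => comp_mem_envelopingSemigroup hp hq) hp

/-- Since `p` is a homeomorphism, the image of `μ` is again regular, hence determined by its
integrals of continuous functions. -/
theorem IsWeaklyAlmostPeriodic.measure_preimage {μ : Measure X}
  [IsFiniteMeasure μ] [μ.IsOpenPosMeasure] [SMulInvariantMeasure T X μ]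
    [μ.Regular] (hwap : IsWeaklyAlmostPeriodic T X)
    {p : X → X} (hp : p ∈ envelopingSemigroup T X) {B : Set X} (hB : MeasurableSet B) :
    μ (p ⁻¹' B) = μ B := by
  obtain ⟨q, hq, hqp, hpq⟩ := hwap.exists_inverse (μ := μ) hp
  have hpc := hwap.continuous_of_mem_envelopingSemigroup hp
  let e : X ≃ₜ X := ⟨⟨p, q, hqp, hpq⟩, hpc, hwap.continuous_of_mem_envelopingSemigroup hq⟩
  have : (μ.map p).Regular := Measure.Regular.map e
  have hmap : μ.map p = μ := by
    refine Measure.ext_of_integral_eq_on_compactlySupported fun f => ?_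
    refine (integral_map hpc.measurable.aemeasurable
      f.continuous.aestronglyMeasurable_of_compactSpace).trans ?_
    exact hwap.integral_comp_eq f.toContinuousMap hp
  conv_rhs => rw [← hmap, Measure.map_apply hpc.measurable hB]

/-- In the equicontinuous situation, transformations in the enveloping semigroup which almost
preserve `f` move points to all points of a neighbourhood. -/
theorem IsWeaklyAlmostPeriodic.setOf_exists_apply_eq_mem_nhds {μ : Measure X}
  [IsFiniteMeasure μ] [μ.IsOpenPosMeasure] [SMulInvariantMeasure T X μ]
    [MulAction.IsMinimal T X]
    (hwap : IsWeaklyAlmostPeriodic T X) (f : C(X, ℝ))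
    (heq : ∀ ε : ℝ, 0 < ε → ∀ x, ∃ W, IsOpen W ∧ x ∈ W ∧
      ∀ k ∈ translateClosure T f, ∀ y ∈ W, ∀ z ∈ W, |k y - k z| ≤ ε)
    {ε : ℝ} (hε : 0 < ε) (z : X) :
    {y | ∃ h ∈ envelopingSemigroup T X, (∀ x, |f (h x) - f x| ≤ ε) ∧ h y = z} ∈ 𝓝 z := by
  rw [mem_iff_ultrafilter]
  intro g hg
  -- `p y` carries `z` to `y`. Dividing by the limit `p₀`, which fixes `z`, gives maps tending to
  -- the identity; their inverses carry `y` back to `z`.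
  choose p hpE hpz using fun y => exists_mem_envelopingSemigroup_apply_eq (T := T) z y
  obtain ⟨p₀, hp₀E, hp₀⟩ := (isCompact_envelopingSemigroup (T := T) (X := X)).ultrafilter_le_nhds
    (g.map p) (le_principal_iff.2 (Filter.mem_map.2 (univ_mem' hpE)))
  have hlim : ∀ x, Tendsto (fun y => p y x) g (𝓝 (p₀ x)) := fun x =>
    ((continuous_apply x).tendsto p₀).comp hp₀
  have hfix : p₀ z = z := by
    refine tendsto_nhds_unique (hlim z) ?_
    simp only [hpz]
    exact hg
  obtain ⟨q, hqE, hqp, hpq⟩ := hwap.exists_inverse (μ := μ) hp₀E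
  have hqz : q z = z := by
    conv_lhs => rw [← hfix]
    exact hqp z
  have hev := eventually_forall_abs_sub_le f heq (p := fun y => p y ∘ q)
    (fun y => comp_mem_envelopingSemigroup (hpE y) hqE)
    (fun x => by simpa [hpq] using hlim (q x)) hε
  refine hev.mono fun y hy => ?_
  obtain ⟨r, hrE, hr, hr'⟩ := hwap.exists_inverse (μ := μ)
    (comp_mem_envelopingSemigroup (hpE y) hqE)
  refine ⟨r, hrE, fun x => ?_, ?_⟩
  · have := hy (r x)
    rw [hr'] at this
    rwa [abs_sub_comm]
  · have := hr z
    rwa [Function.comp_apply, hqz, hpz] at this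

/-- Every closed set of an equicontinuous minimal system contains a closed `Gδ` set of the same
measure for a regular invariant `μ`; so `μ` is dominated on closed sets by any Borel measure which
defines the same functional. -/
theorem IsWeaklyAlmostPeriodic.measure_le_of_isClosed {μ : Measure X}
  [IsFiniteMeasure μ] [μ.IsOpenPosMeasure] [SMulInvariantMeasure T X μ]
    [μ.Regular] [MulAction.IsMinimal T X]
    (hwap : IsWeaklyAlmostPeriodic T X)
    (heq : ∀ (f : C(X, ℝ)) (ε : ℝ), 0 < ε → ∀ x, ∃ W, IsOpen W ∧ x ∈ W ∧
      ∀ k ∈ translateClosure T f, ∀ y ∈ W, ∀ z ∈ W, |k y - k z| ≤ ε)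
    (ν : Measure X) [IsFiniteMeasure ν] (hν : ∀ f : C(X, ℝ), ∫ x, f x ∂ν = ∫ x, f x ∂μ)
    {F : Set X} (hF : IsClosed F) : μ F ≤ ν F := by
  obtain ⟨Z₀, hZ₀c, hZ₀G, hFZ₀, hZ₀⟩ : ∃ Z₀ : Set X, IsClosed Z₀ ∧ IsGδ Z₀ ∧ F ⊆ Z₀ ∧
      μ (Z₀ \ F) = 0 := by
    choose U hFU hUo hU using fun n : ℕ => hF.measurableSet.exists_isOpen_sdiff_lt
      (measure_ne_top μ F) (ε := ((n : ENNReal) + 1)⁻¹) (by simp)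
    choose φ hφ0 hφ1 _ using fun n => exists_continuous_zero_one_of_isClosed hF
      (hUo n).isClosed_compl (disjoint_compl_right_iff_subset.2 (hFU n))
    refine ⟨⋂ n, φ n ⁻¹' {0}, ?_, ?_, subset_iInter fun n x hx => hφ0 n hx, ?_⟩
    · exact isClosed_iInter fun n => isClosed_singleton.preimage (φ n).continuous
    · exact .iInter fun n => (isClosed_singleton (x := (0 : ℝ))).isGδ.preimage (φ n).continuous
    · have hle : ∀ n : ℕ, μ ((⋂ n, φ n ⁻¹' {0}) \ F) ≤ ((n : ENNReal) + 1)⁻¹ := by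
        intro n
        refine (measure_mono ?_).trans (hU n).2.le
        intro x hx
        refine ⟨?_, hx.2⟩
        by_contra hxU
        have h0 : φ n x = 0 := mem_iInter.1 hx.1 n
        have h1 : φ n x = 1 := hφ1 n hxU
        linarith
      have hlim := (tendsto_add_atTop_iff_nat 1).2 ENNReal.tendsto_inv_nat_nhds_zero
      simp only [Nat.cast_add, Nat.cast_one] at hlim
      exact le_antisymm (ge_of_tendsto' hlim hle) zero_le
  obtain ⟨f, hfZ₀, -, -, -⟩ := exists_continuous_one_zero_of_isCompact_of_isGδ hZ₀c.isCompact
    hZ₀G isClosed_empty (disjoint_empty _)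
  let E := envelopingSemigroup T X
  -- `N` is the stabiliser of `f`, so it preserves `Z₀`, and `Z` is the part of `F` that `N` keeps
  -- inside `F`. Then `F \ Z` is covered by the null sets `g ⁻¹' (Z₀ \ F)`. There may be uncountably
  -- many, so inner regularity reduces the claim to compact sets and finite subcovers.
  let N : Set (X → X) := {g ∈ E | ∀ x, f (g x) = f x}
  have hNmul : ∀ g ∈ N, ∀ h ∈ N, g ∘ h ∈ N := fun g hg h hh =>
    ⟨comp_mem_envelopingSemigroup hg.1 hh.1, fun x => (hg.2 (h x)).trans (hh.2 x)⟩
  let Z : Set X := {x | ∀ g ∈ N, g x ∈ F}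
  have hcE : ∀ g ∈ E, Continuous g := fun g hg => hwap.continuous_of_mem_envelopingSemigroup hg
  have hZc : IsClosed Z := by
    simp only [Z, ofPred_forall]
    exact isClosed_iInter fun g => isClosed_iInter fun hg => hF.preimage (hcE g hg.1)
  have hZF : Z ⊆ F := fun x hx => hx _ ⟨one_mem_envelopingSemigroup, fun _ => rfl⟩
  have hμZ : μ (F \ Z) = 0 := by
    rw [(hF.measurableSet.diff hZc.measurableSet).measure_eq_iSup_isCompact_of_ne_top
      (measure_ne_top _ _)]
    simp only [ENNReal.iSup_eq_zero]
    intro K hKF hK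
    obtain ⟨t, ht⟩ := hK.elim_finite_subcover (fun g : N => g.1 ⁻¹' Fᶜ)
      (fun g => hF.isOpen_compl.preimage (hcE _ g.2.1)) (by
        intro x hx
        obtain ⟨g, hg⟩ := not_forall.1 (hKF hx).2
        obtain ⟨hgN, hg⟩ := Classical.not_imp.1 hg
        exact mem_iUnion.2 ⟨⟨g, hgN⟩, hg⟩)
    refine measure_mono_null (fun x hx => ?_ : K ⊆ ⋃ g ∈ t, (g : X → X) ⁻¹' (Z₀ \ F))
      ((measure_biUnion_null_iff t.countable_toSet).2 fun g _ => ?_)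
    · obtain ⟨g, hg, hgx⟩ := mem_iUnion₂.1 (ht hx)
      refine mem_iUnion₂.2 ⟨g, hg, ?_, hgx⟩
      have h1 := hFZ₀ (hKF hx).1
      rw [hfZ₀] at h1 ⊢
      exact (g.2.2 x).trans h1
    · rw [hwap.measure_preimage g.2.1 (hZ₀c.measurableSet.diff hF.measurableSet), hZ₀]
  let W : ℕ → Set X := fun n =>
    {y | ∃ h ∈ E, (∀ x, |f (h x) - f x| ≤ 1 / ((n : ℝ) + 1)) ∧ h y ∈ Z}
  have hZW : ∀ n, Z ⊆ interior (W n) := by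
    intro n z hz
    rw [mem_interior_iff_mem_nhds]
    refine mem_of_superset (hwap.setOf_exists_apply_eq_mem_nhds (μ := μ) f (heq f)
      (ε := 1 / ((n : ℝ) + 1)) (by positivity) z) ?_
    rintro y ⟨h, hE, hf, rfl⟩
    exact ⟨h, hE, hf, hz⟩
  -- Compactness of `E` produces one `h` that preserves `f` exactly with `h y ∈ Z`. Its inverse `q`
  -- lies in `N`, so `g y = (g ∘ q) (h y) ∈ F` for each `g ∈ N`.
  have hWZ : ⋂ n, W n ⊆ Z := by
    intro y hy
    let H : ℕ → Set (X → X) := fun n =>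
      E ∩ ({h | ∀ x, |f (h x) - f x| ≤ 1 / ((n : ℝ) + 1)} ∩ {h | h y ∈ Z})
    have hHc : ∀ n, IsClosed (H n) := by
      intro n
      refine isClosed_closure.inter (IsClosed.inter ?_ (hZc.preimage (continuous_apply y)))
      simp only [ofPred_forall]
      exact isClosed_iInter fun x => isClosed_le (by fun_prop) continuous_const
    obtain ⟨h, hh⟩ := IsCompact.nonempty_iInter_of_sequence_nonempty_isCompact_isClosed H
      (by
        rintro n h ⟨h1, h2, h3⟩
        exact ⟨h1, fun x => (h2 x).trans (Nat.one_div_le_one_div n.le_succ), h3⟩)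
      (fun n => by
        obtain ⟨h, h1, h2, h3⟩ := mem_iInter.1 hy n
        exact ⟨h, h1, h2, h3⟩)
      (hHc 0).isCompact hHc
    have hh' := fun n => mem_iInter.1 hh n
    have hfh : ∀ x, f (h x) = f x := by
      intro x
      have : |f (h x) - f x| ≤ 0 := ge_of_tendsto' tendsto_one_div_add_atTop_nhds_zero_nat
        fun n => (hh' n).2.1 x
      exact sub_eq_zero.1 (abs_nonpos_iff.1 this)
    obtain ⟨q, hqE, hq, hq'⟩ := hwap.exists_inverse (μ := μ) (hh' 0).1
    have hqN : q ∈ N := ⟨hqE, fun x => by rw [← hfh (q x), hq']⟩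
    intro g hg
    have := (hh' 0).2.2 (g ∘ q) (hNmul g hg q hqN)
    simpa [hq] using this
  have hZG : IsGδ Z := by
    have : Z = ⋂ n, interior (W n) := Subset.antisymm (subset_iInter hZW)
      ((iInter_mono fun n => interior_subset).trans hWZ)
    rw [this]
    exact .iInter_of_isOpen fun n => isOpen_interior
  obtain ⟨u, hu, -, -, -⟩ := exists_continuous_one_zero_of_isCompact_of_isGδ hZc.isCompact
    hZG isClosed_empty (disjoint_empty _)
  -- On the real line, finite Borel measures are determined by integrals of bounded continuous
  -- functions, and `Z` is the preimage of `{1}` under `u`.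
  have hmap : μ.map u = ν.map u := by
    refine ext_of_forall_integral_eq_of_IsFiniteMeasure fun φ => ?_
    rw [integral_map u.continuous.measurable.aemeasurable φ.continuous.aestronglyMeasurable,
      integral_map u.continuous.measurable.aemeasurable φ.continuous.aestronglyMeasurable]
    exact (hν (φ.toContinuousMap.comp u)).symm
  calc μ F ≤ μ Z + μ (F \ Z) := by
        rw [← measure_union disjoint_sdiff_right (hF.measurableSet.diff hZc.measurableSet)]
        exact measure_mono (by rw [union_sdiff_self]; exact subset_union_right)
    _ = μ.map u {1} := by
        rw [hμZ, add_zero, Measure.map_apply u.continuous.measurable (measurableSet_singleton _),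
          ← hu]
    _ = ν Z := by
        rw [hmap, Measure.map_apply u.continuous.measurable (measurableSet_singleton _), ← hu]
    _ ≤ ν F := measure_mono hZF

end CompletionRegular

/-! ### Existence of a regular invariant measure, and conclusion -/

theorem IsAmenable.exists_isInvariantProbability {T : Type u} {X : Type v} [TopologicalSpace T]
    [Monoid T] [TopologicalSpace X] [CompactSpace X] [T2Space X] [Nonempty X]
    [MeasurableSpace X] [BorelSpace X] [MulAction T X] [ContinuousSMul T X]
    (hamen : IsAmenable.{u, v} T) : ∃ μ : Measure X, IsInvariantProbability T μ := by
  have : ContinuousSMul T (ULift.{u} X) :=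
    ⟨continuous_uliftUp.comp
      (continuous_fst.smul (continuous_uliftDown.comp continuous_snd))⟩
  obtain ⟨μ, hμ, hinv⟩ := hamen (ULift.{u} X)
  refine ⟨μ.map ULift.down, Measure.isProbabilityMeasure_map measurable_down.aemeasurable,
    ⟨fun t B hB => ?_⟩⟩
  rw [Measure.map_apply measurable_down hB, Measure.map_apply measurable_down
    ((continuous_const_smul t).measurable hB)]
  exact hinv.measure_preimage_smul t (measurable_down hB)

/-- The Riesz measure `ν` of the functional of `μ` may differ from `μ`. Each `t` acts as a
homeomorphism, so its image of `ν` is regular with the same integrals, hence equal to `ν`. -/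
theorem exists_regular_isInvariantProbability {T X : Type*} [TopologicalSpace X] [CompactSpace X]
    [T2Space X] [MeasurableSpace X] [BorelSpace X] [Monoid T] [MulAction T X]
    [ContinuousConstSMul T X] (hbij : ∀ t : T, Function.Bijective (fun x : X => t • x))
    {μ : Measure X} (hμ : IsInvariantProbability T μ) :
    ∃ ν : Measure X, ν.Regular ∧ IsInvariantProbability T ν := by
  have := hμ.1
  have := hμ.2
  obtain ⟨ν, hreg, hfin, hν⟩ := Measure.exists_regular_eq_of_compactSpace μ
  have hν' : ∀ f : C(X, ℝ), ∫ x, f x ∂μ = ∫ x, f x ∂ν := fun f =>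
    hν (BoundedContinuousFunction.mkOfCompact f)
  refine ⟨ν, hreg, ⟨⟨?_⟩, ⟨fun t B hB => ?_⟩⟩⟩
  · have := hν' 1
    simp only [ContinuousMap.one_apply, integral_const, smul_eq_mul, mul_one, probReal_univ] at this
    rw [← ENNReal.toReal_eq_one_iff]
    exact this.symm
  · have hc : Continuous fun x : X => t • x := continuous_const_smul t
    let e : X ≃ₜ X := hc.homeoOfEquivCompactToT2 (f := Equiv.ofBijective _ (hbij t))
    have : (ν.map fun x => t • x).Regular := Measure.Regular.map e
    have hmap : ν.map (fun x => t • x) = ν := by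
      refine Measure.ext_of_integral_eq_on_compactlySupported fun f => ?_
      refine (integral_map hc.measurable.aemeasurable
        f.continuous.aestronglyMeasurable_of_compactSpace).trans ?_
      exact (hν' (actionTranslate f.toContinuousMap t)).symm.trans
        ((integral_translate_eq f.toContinuousMap t).trans (hν' f.toContinuousMap))
    conv_rhs => rw [← hmap, Measure.map_apply hc.measurable hB]

/-- Complements bound `ν` by `μ` on open sets; inner regularity of `μ` gives the reverse, so `ν`
itself need not be assumed regular. -/
theorem eq_of_forall_isClosed_measure_le {X : Type*} [TopologicalSpace X] [T2Space X]
    [CompactSpace X] [MeasurableSpace X] [BorelSpace X] {μ ν : Measure X} [μ.Regular]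
    [IsProbabilityMeasure μ] [IsProbabilityMeasure ν]
    (h : ∀ F : Set X, IsClosed F → μ F ≤ ν F) : ν = μ := by
  refine ext_of_generate_finite _ (BorelSpace.measurable_eq (α := X)) isPiSystem_isOpen
    (fun U hU => le_antisymm ?_ ?_) (by simp)
  · have h1 := h _ hU.isClosed_compl
    rw [prob_compl_eq_one_sub hU.measurableSet, prob_compl_eq_one_sub hU.measurableSet] at h1
    exact (ENNReal.sub_le_sub_iff_left prob_le_one ENNReal.one_ne_top).1 h1
  · rw [hU.measure_eq_iSup_isCompact μ]
    exact iSup₂_le fun K hKU => iSup_le fun hK => (h K hK.isClosed).trans (measure_mono hKU)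

theorem mainTheorem10 {T : Type u} {X : Type v}
    [TopologicalSpace T] [Monoid T] [ContinuousMul T]
    [TopologicalSpace X] [CompactSpace X] [T2Space X] [Nonempty X]
    [MeasurableSpace X] [BorelSpace X]
    [MulAction T X] [ContinuousSMul T X]
    (hmin : MulAction.IsMinimal T X)
    (hwap : IsWeaklyAlmostPeriodic T X)
    (hamen : IsAmenable.{u, v} T)
    (hbij : ∀ t : T, Function.Bijective (fun x : X => t • x)) :
    IsUniquelyErgodic T X := by
  obtain ⟨μ₀, hμ₀⟩ := hamen.exists_isInvariantProbability (X := X)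
  obtain ⟨μ, hreg, hμ⟩ := exists_regular_isInvariantProbability hbij hμ₀
  have := hμ.1
  have := hμ.2
  have : μ.IsOpenPosMeasure := isOpenPosMeasure_of_isMinimal (T := T)
  have heq := fun (f : C(X, ℝ)) (ε : ℝ) (hε : 0 < ε) =>
    hwap.exists_isOpen_forall_abs_sub_le (μ := μ) hbij f hε
  refine ⟨μ, hμ, fun ν hν => ?_⟩
  have := hν.1
  refine eq_of_forall_isClosed_measure_le fun F hF =>
    hwap.measure_le_of_isClosed heq ν (fun f => ?_) hF
  obtain ⟨M, hM⟩ := exists_forall_integral_eq f (heq f)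
  rw [hM ν hν, hM μ hμ]
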